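/- Let $a<T$, $J=[a,T]$, $0<\alpha\le 1$, $0\le\beta\le 1$, $\gamma=\alpha+\beta(1-\alpha)$, and let $\psi\in C^1(J,\mathbb R)$ be increasing with $\psi'(t)\ne 0$ for all $t\in J$. For $\mu>0$ let $$I_{a+}^{\mu;\psi}h(t)=\frac1{\Gamma(\mu)}\int_a^t\psi'(s)(\psi(t)-\psi(s))^{\mu-1}h(s)\,ds,\qquad I_{a+}^{0;\psi}h=h .$$ Let $C_{1-\gamma;\psi}(J)$ be the space of functions $u:(a,T]\to\mathbb R$ such that $(\psi(t)-\psi(a))^{1-\gamma}u(t)$ extends to a continuous function on $J$; for such $u$ let $I_{a+}^{1-\gamma;\psi}u(a)$ denote $\lim_{t\to a+}I_{a+}^{1-\gamma;\psi}u(t)$. The $\psi$-Hilfer derivative of $u$ of order $\alpha$ and type $\beta$ is $$\mathbb D u(t)=\frac{1}{\psi'(t)}\frac{d}{dt}\,I_{a+}^{\beta(1-\alpha);\psi}\Big(I_{a+}^{(1-\beta)(1-\alpha);\psi}u-I_{a+}^{(1-\beta)(1-\alpha);\psi}u(a)\Big)(t),\qquad t\in(a,T],$$ which equals $I_{a+}^{\beta(1-\alpha);\psi}\big(\tfrac1{\psi'}\tfrac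 d{dt}\big)I_{a+}^{(1-\beta)(1-\alpha);\psi}u(t)$ whenever the latter is defined (with $\big(\tfrac1{\psi'}\tfrac d{dt}\big)I_{a+}^{(1-\beta)(1-\alpha);\psi}u$ integrable) and continuous on $(a,T]$. Assume: (H1) $f:J\times\mathbb R\times\mathbb R\to\mathbb R$ is continuous; (H2) there are $k,l>0$ with $|f(t,u,v)-f(t,\bar u,\bar v)|\le k|u-\bar u|+l|v-\bar v|$ for all $t\in J$ and $u,v,\bar u,\bar v\in\mathbb R$; and $\dfrac{k}{\Gamma(\alpha+1)}(\psi(T)-\psi(a))^\alpha+l<1$; (H3) $\varphi:J\to[0,\infty)$ is continuous and increasing (in the wide sense), and there is $\lambda_\varphi>0$ with $I_{a+}^{\alpha;\psi}\varphi(t)\le\lambda_\varphi\,\varphi(t)$ for all $t\in J$. Then the problem $$\mathbb D y(t)=f(t,y(t),\mathbb D y(t)),\quad t\in(a,T],\qquad I_{a+}^{1-\gamma;\psi}y(a)=y_a \tag{1}$$ is Ulam–Hyers–Rassias stable with respect to $\varphi$, with the constant $$c_f=\Big[1-\frac{k(\psi(T)-\psi(a))^\alpha}{(1-l)\Gamma(\alpha+1)}\Big]^{-1}\frac{\lambda_\varphi}{1-l}>0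 .$$ That is: for every $\varepsilon>0$ and every $z\in C_{1-\gamma;\psi}(J)$ that has a $\psi$-Hilfer derivative $\mathbb D z$, continuous on $(a,T]$, with $|\mathbb D z(t)-f(t,z(t),\mathbb D z(t))|\le\varepsilon\varphi(t)$ for $t\in(a,T]$, there is a $y\in C_{1-\gamma;\psi}(J)$ with $\mathbb D y$ continuous on $(a,T]$ that solves (1) with $y_a=I_{a+}^{1-\gamma;\psi}z(a)$ and satisfies $|z(t)-y(t)|\le c_f\,\varepsilon\,\varphi(t)$ for all $t\in(a,T]$. -/

import Mathlib

open Set Filter Topology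

namespace PsiHilfer

/-- The left-sided Riemann-Liouville fractional integral of order `μ ≥ 0` of `h` with respect to
the function `ψ`, based at `a`:
`(1 / Γ(μ)) ∫_a^t ψ'(s) (ψ(t) - ψ(s))^(μ-1) h(s) ds` for `μ > 0`, and the identity for `μ = 0`. -/
noncomputable def fracIntegral (a : ℝ) (ψ : ℝ → ℝ) (μ : ℝ) (h : ℝ → ℝ) (t : ℝ) : ℝ :=
  if μ = 0 then h t
  else (1 / Real.Gamma μ) * ∫ s in a..t, deriv ψ s * (ψ t - ψ s) ^ (μ - 1) * h s

/-- The parameter `γ = α + β (1 - α)`. -/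
noncomputable def gam (α β : ℝ) : ℝ := α + β * (1 - α)

/-- The weighted space `C_{1-γ;ψ}[a,T]`: functions `u` on `(a,T]` such that
`(ψ(t) - ψ(a))^(1-γ) u(t)` is (extends to) a continuous function on `[a,T]`. -/
def MemWeighted (a T : ℝ) (ψ : ℝ → ℝ) (γ : ℝ) (u : ℝ → ℝ) : Prop :=
  ∃ h : ℝ → ℝ, ContinuousOn h (Icc a T) ∧
    ∀ t ∈ Ioc a T, (ψ t - ψ a) ^ (1 - γ) * u t = h t

/-- The initial value `I_{a+}^{1-γ;ψ} u (a) = L`, understood as the limit at `a+`. -/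
def HasInitialValue (a : ℝ) (ψ : ℝ → ℝ) (α β : ℝ) (u : ℝ → ℝ) (L : ℝ) : Prop :=
  Tendsto (fracIntegral a ψ (1 - gam α β) u) (𝓝[>] a) (𝓝 L)

/-- `g` is the left-sided `ψ`-Hilfer fractional derivative of `u` on `(a,T]`, of order `α ∈ (0,1]`
and type `β ∈ [0,1]`.

With `F = I^{(1-β)(1-α);ψ} u` and `δ = (1/ψ') d/dt`, the expression `I^{β(1-α);ψ} (δ F)` is taken in
the form `δ (I^{β(1-α);ψ} (F - F(a+)))`. The two coincide whenever `F` is differentiable with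
`δ F` integrable and the first expression is continuous on `(a,T]`, because then
`F - F(a+) = I^{1;ψ} (δ F)` and the fractional integrals commute. For `β = 0` the definition is
the Riemann-Liouville derivative, for `β = 1` it is the Caputo derivative
`D^{α;ψ} (u - u(a))` (the Riemann-Liouville derivative of `u - u(a)`). As for these, the second form
makes sense for all functions `I^{α;ψ} w` with `w` continuous. Here `(1-β)(1-α) = 1 - γ`. -/
def HasHilferDeriv (a T : ℝ) (ψ : ℝ → ℝ) (α β : ℝ) (u g : ℝ → ℝ) : Prop :=
  ∃ L : ℝ, HasInitialValue a ψ α β u L ∧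
    ∀ t ∈ Ioc a T,
      HasDerivWithinAt
        (fracIntegral a ψ (β * (1 - α)) (fun s => fracIntegral a ψ (1 - gam α β) u s - L))
        (derivWithin ψ (Icc a T) t * g t) (Ioc a T) t

/-- `z ∈ C_{1-γ;ψ}[a,T]` has a continuous `ψ`-Hilfer derivative `Dz` on `(a,T]` and solves the
inequality `|Dz(t) - f(t, z(t), Dz(t))| ≤ r(t)` there. -/
def SolvesInequality (a T : ℝ) (ψ : ℝ → ℝ) (α β : ℝ) (f : ℝ → ℝ → ℝ → ℝ) (r z : ℝ → ℝ) : Prop :=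
  MemWeighted a T ψ (gam α β) z ∧
    ∃ g : ℝ → ℝ, ContinuousOn g (Ioc a T) ∧ HasHilferDeriv a T ψ α β z g ∧
      ∀ t ∈ Ioc a T, |g t - f t (z t) (g t)| ≤ r t

/-- `y ∈ C_{1-γ;ψ}[a,T]` has a continuous `ψ`-Hilfer derivative `Dy` on `(a,T]` and solves the
Cauchy problem `Dy(t) = f(t, y(t), Dy(t))` for `t ∈ (a,T]`, `I_{a+}^{1-γ;ψ} y (a) = ya`. -/
def SolvesCauchy (a T : ℝ) (ψ : ℝ → ℝ) (α β : ℝ) (f : ℝ → ℝ → ℝ → ℝ) (ya : ℝ) (y : ℝ → ℝ) :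
    Prop :=
  MemWeighted a T ψ (gam α β) y ∧ HasInitialValue a ψ α β y ya ∧
    ∃ g : ℝ → ℝ, ContinuousOn g (Ioc a T) ∧ HasHilferDeriv a T ψ α β y g ∧
      ∀ t ∈ Ioc a T, g t = f t (y t) (g t)

/-- Ulam-Hyers-Rassias stability with respect to `φ`, with the constant `c > 0`: for every `ε > 0`,
near every solution `z` of the inequality with right-hand side `ε φ` there is a solution `y` of the
Cauchy problem that has the initial value of `z`. -/
def UlamHyersRassiasStableWith (a T : ℝ) (ψ : ℝ → ℝ) (α β : ℝ) (f : ℝ → ℝ → ℝ → ℝ)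
    (φ : ℝ → ℝ) (c : ℝ) : Prop :=
  0 < c ∧ ∀ ε : ℝ, 0 < ε → ∀ z : ℝ → ℝ,
    SolvesInequality a T ψ α β f (fun t => ε * φ t) z →
      ∃ (ya : ℝ) (y : ℝ → ℝ), HasInitialValue a ψ α β z ya ∧
        SolvesCauchy a T ψ α β f ya y ∧
        ∀ t ∈ Ioc a T, |z t - y t| ≤ c * ε * φ t

end PsiHilfer

/-! The substitution `x = ψ t - ψ a` turns every `ψ`-integral into a classical Riemann-Liouville
integral `rl` on `(0, R]`, `R = ψ T - ψ a`. Let `g` be the Hilfer derivative of `z`. The solution is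
sought as a perturbation `y = z + I^α V` of `z` itself, with `V` continuous and bounded. No
inversion formula for `z` is needed: the initial value is unchanged because `I^(1-γ) I^α V` vanishes
at `a`, and the derivative becomes `g + V` because `β(1-α) + (1-γ) + α = 1`, so that the three
integrals compose to `I^1 V` (`rl_rl`), whose derivative is `V` (`hasDerivWithinAt_rl_one`).

The problem becomes the fixed-point equation `V = f(·, z + I^α V, g + V) - g`. Its right-hand side
is a contraction in the sup norm with factor `q = kK + l`, where `K = R^α / Γ(α+1)`, and it
preserves the set `|V| ≤ M φ` for `M = ε / (1 - q)` because `φ` is increasing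
(`exists_perturbation_fixedPoint`). Finally `|z - y| = |I^α V| ≤ M I^α φ ≤ M λ φ`, and `M λ` is the
required constant times `ε`. -/

namespace RiemannLiouville

open MeasureTheory

/-- The classical Riemann-Liouville integral of order `μ ≥ 0` based at `0`. -/
noncomputable def rl (μ : ℝ) (h : ℝ → ℝ) (x : ℝ) : ℝ :=
  if μ = 0 then h x
  else (1 / Real.Gamma μ) * ∫ y in (0 : ℝ)..x, (x - y) ^ (μ - 1) * h y

/-- `Z` is continuous on `(0, R]` and at most `C y ^ (ρ - 1)` there. -/
def WeightedBound (R ρ C : ℝ) (Z : ℝ → ℝ) : Prop :=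
  ContinuousOn Z (Ioc 0 R) ∧ ∀ y ∈ Ioc 0 R, |Z y| ≤ C * y ^ (ρ - 1)

/-! ### Beta integrals and power kernels -/

theorem betaIntegrand_ofReal {μ ρ σ : ℝ} (hσ : σ ∈ Icc (0 : ℝ) 1) :
    ((σ : ℂ) ^ ((ρ : ℂ) - 1) * (1 - (σ : ℂ)) ^ ((μ : ℂ) - 1)) =
      (((1 - σ) ^ (μ - 1) * σ ^ (ρ - 1) : ℝ) : ℂ) := by
  rw [mul_comm, Complex.ofReal_mul, Complex.ofReal_cpow (by linarith [hσ.2]),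
    Complex.ofReal_cpow hσ.1]
  push_cast
  rfl

theorem intervalIntegrable_beta {μ ρ : ℝ} (hμ : 0 < μ) (hρ : 0 < ρ) :
    IntervalIntegrable (fun σ : ℝ => (1 - σ) ^ (μ - 1) * σ ^ (ρ - 1)) volume 0 1 := by
  have h := (Complex.betaIntegral_convergent (u := ρ) (v := μ) (by simpa) (by simpa)).norm
  refine h.congr fun σ hσ => ?_
  rw [uIoc_of_le zero_le_one] at hσ
  have h1 : 0 ≤ 1 - σ := by linarith [hσ.2]
  rw [betaIntegrand_ofReal ⟨hσ.1.le, hσ.2⟩, Complex.norm_real, Real.norm_of_nonneg]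
  exact mul_nonneg (Real.rpow_nonneg h1 _) (Real.rpow_nonneg hσ.1.le _)

theorem integral_beta {μ ρ : ℝ} (hμ : 0 < μ) (hρ : 0 < ρ) :
    ∫ σ in (0 : ℝ)..1, (1 - σ) ^ (μ - 1) * σ ^ (ρ - 1) =
      Real.Gamma μ * Real.Gamma ρ / Real.Gamma (μ + ρ) := by
  have h : Complex.betaIntegral ρ μ =
      ((∫ σ in (0 : ℝ)..1, (1 - σ) ^ (μ - 1) * σ ^ (ρ - 1) : ℝ) : ℂ) := by
    rw [Complex.betaIntegral, ← intervalIntegral.integral_ofReal]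
    refine intervalIntegral.integral_congr fun σ hσ => ?_
    rw [uIcc_of_le zero_le_one] at hσ
    exact betaIntegrand_ofReal hσ
  have h2 := ProbabilityTheory.beta_eq_betaIntegralReal ρ μ hρ hμ
  rw [h, Complex.ofReal_re] at h2
  rw [← h2, ProbabilityTheory.beta, mul_comm, add_comm]

/-- The scaling `y = x σ` fixes the domain of integration and pulls the singular powers of `x` out;
what remains depends on `x` only through `h (x * σ)`. -/
theorem integral_kernel_mul_comp_mul {μ ρ x : ℝ} (hx : 0 < x) (h : ℝ → ℝ) :
    ∫ y in (0 : ℝ)..x, (x - y) ^ (μ - 1) * (y ^ (ρ - 1) * h y) =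
      x ^ (μ + ρ - 1) * ∫ σ in (0 : ℝ)..1, (1 - σ) ^ (μ - 1) * σ ^ (ρ - 1) * h (x * σ) := by
  have key := intervalIntegral.mul_integral_comp_mul_left (a := 0) (b := 1) (c := x)
    (f := fun y => (x - y) ^ (μ - 1) * (y ^ (ρ - 1) * h y))
  rw [mul_zero, mul_one] at key
  rw [← key, ← intervalIntegral.integral_const_mul, ← intervalIntegral.integral_const_mul]
  refine intervalIntegral.integral_congr fun σ hσ => ?_
  rw [uIcc_of_le zero_le_one] at hσ
  have e1 : x - x * σ = x * (1 - σ) := by ring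
  have e2 : x ^ (μ + ρ - 1) = x * x ^ (μ - 1) * x ^ (ρ - 1) := by
    nth_rw 2 [← Real.rpow_one x]
    rw [← Real.rpow_add hx, ← Real.rpow_add hx]
    ring_nf
  rw [e1, e2, Real.mul_rpow hx.le (by linarith [hσ.2]), Real.mul_rpow hx.le hσ.1]
  ring

theorem intervalIntegrable_kernel {μ ρ x : ℝ} (hμ : 0 < μ) (hρ : 0 < ρ) (hx : 0 < x) :
    IntervalIntegrable (fun y : ℝ => (x - y) ^ (μ - 1) * y ^ (ρ - 1)) volume 0 x := by
  have h := ((intervalIntegrable_beta hμ hρ).comp_mul_left (c := x⁻¹)).const_mul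
    (x ^ (μ - 1) * x ^ (ρ - 1))
  simp only [div_inv_eq_mul, one_mul, zero_mul] at h
  refine h.congr fun y hy => ?_
  rw [uIoc_of_le hx.le] at hy
  have e1 : x - y = x * (1 - x⁻¹ * y) := by field_simp
  have e2 : y = x * (x⁻¹ * y) := by field_simp
  have h1 : 0 ≤ 1 - x⁻¹ * y := by
    rw [inv_mul_eq_div, sub_nonneg, div_le_one hx]; exact hy.2
  have h2 : 0 ≤ x⁻¹ * y := mul_nonneg (inv_nonneg.2 hx.le) hy.1.le
  rw [e1, Real.mul_rpow hx.le h1]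
  nth_rw 4 [e2]
  rw [Real.mul_rpow hx.le h2]
  ring

theorem integral_kernel {μ ρ x : ℝ} (hμ : 0 < μ) (hρ : 0 < ρ) (hx : 0 < x) :
    ∫ y in (0 : ℝ)..x, (x - y) ^ (μ - 1) * y ^ (ρ - 1) =
      Real.Gamma μ * Real.Gamma ρ / Real.Gamma (μ + ρ) * x ^ (μ + ρ - 1) := by
  have h := integral_kernel_mul_comp_mul (μ := μ) (ρ := ρ) hx (fun _ => 1)
  simp only [mul_one] at h
  rw [h, integral_beta hμ hρ, mul_comm]

theorem integral_kernel_shift {μ ν s x : ℝ} (hμ : 0 < μ) (hν : 0 < ν) (hx : s < x) :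
    ∫ τ in s..x, (x - τ) ^ (μ - 1) * (τ - s) ^ (ν - 1) =
      Real.Gamma μ * Real.Gamma ν / Real.Gamma (μ + ν) * (x - s) ^ (μ + ν - 1) := by
  rw [← integral_kernel hμ hν (sub_pos.2 hx)]
  have h := intervalIntegral.integral_comp_sub_right (a := s) (b := x)
    (fun y => (x - s - y) ^ (μ - 1) * y ^ (ν - 1)) s
  rw [sub_self] at h
  rw [← h]
  refine intervalIntegral.integral_congr fun τ _ => ?_
  congr 2
  ring

theorem intervalIntegrable_kernel_shift {μ ν s x : ℝ} (hμ : 0 < μ) (hν : 0 < ν) (hx : s < x) :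
    IntervalIntegrable (fun τ => (x - τ) ^ (μ - 1) * (τ - s) ^ (ν - 1)) volume s x := by
  have h := (intervalIntegrable_kernel hμ hν (sub_pos.2 hx)).comp_sub_right s
  rw [zero_add, sub_add_cancel] at h
  refine h.congr fun τ _ => ?_
  congr 2
  ring

theorem rpow_mul_rpow_neg {y ρ : ℝ} (hy : 0 < y) : y ^ (ρ - 1) * y ^ (1 - ρ) = 1 := by
  rw [← Real.rpow_add hy]; simp

/-! ### Fractional integrals of functions with a power singularity at 0 -/

namespace WeightedBound

variable {R ρ C : ℝ} {Z : ℝ → ℝ}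

theorem mono_right (hZ : WeightedBound R ρ C Z) {x : ℝ} (hx : x ≤ R) : WeightedBound x ρ C Z :=
  ⟨hZ.1.mono (Ioc_subset_Ioc_right hx), fun y hy => hZ.2 y (Ioc_subset_Ioc_right hx hy)⟩

theorem exists_eq_mul (hZ : WeightedBound R ρ C Z) :
    ∃ h : ℝ → ℝ, ContinuousOn h (Ioc 0 R) ∧ (∀ y ∈ Ioc 0 R, |h y| ≤ C) ∧
      ∀ y ∈ Ioc 0 R, Z y = y ^ (ρ - 1) * h y := by
  refine ⟨fun y => y ^ (1 - ρ) * Z y, ?_, fun y hy => ?_, fun y hy => ?_⟩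
  · exact (continuousOn_id.rpow_const fun y hy => Or.inl hy.1.ne').mul hZ.1
  · have hp := Real.rpow_pos_of_pos hy.1 (1 - ρ)
    rw [abs_mul, abs_of_pos hp]
    calc y ^ (1 - ρ) * |Z y| ≤ y ^ (1 - ρ) * (C * y ^ (ρ - 1)) := by gcongr; exact hZ.2 y hy
      _ = C := by rw [mul_left_comm, mul_comm (y ^ (1 - ρ)), rpow_mul_rpow_neg hy.1, mul_one]
  · rw [← mul_assoc, rpow_mul_rpow_neg hy.1, one_mul]

theorem aestronglyMeasurable (hZ : WeightedBound R ρ C Z) :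
    AEStronglyMeasurable Z (volume.restrict (Ioc 0 R)) :=
  hZ.1.aestronglyMeasurable measurableSet_Ioc

theorem intervalIntegrable (hZ : WeightedBound R ρ C Z) {μ x : ℝ} (hμ : 0 < μ) (hρ : 0 < ρ)
    (hx : x ∈ Ioc 0 R) :
    IntervalIntegrable (fun y => (x - y) ^ (μ - 1) * Z y) volume 0 x := by
  refine ((intervalIntegrable_kernel hμ hρ hx.1).const_mul C).mono_fun ?_ ?_
  · rw [uIoc_of_le hx.1.le]
    exact (by fun_prop : Measurable fun y : ℝ => (x - y) ^ (μ - 1)).aestronglyMeasurable.mul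
      (hZ.mono_right hx.2).aestronglyMeasurable
  · rw [uIoc_of_le hx.1.le]
    filter_upwards [ae_restrict_mem measurableSet_Ioc] with y hy
    have h1 : 0 ≤ (x - y) ^ (μ - 1) := Real.rpow_nonneg (by linarith [hy.2]) _
    rw [norm_mul, Real.norm_of_nonneg h1, Real.norm_eq_abs]
    calc (x - y) ^ (μ - 1) * |Z y| ≤ (x - y) ^ (μ - 1) * (C * y ^ (ρ - 1)) := by
          gcongr; exact hZ.2 y ⟨hy.1, hy.2.trans hx.2⟩
      _ = C * ((x - y) ^ (μ - 1) * y ^ (ρ - 1)) := by ring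
      _ ≤ _ := le_abs_self _

end WeightedBound

theorem rl_congr {μ x : ℝ} {Z W : ℝ → ℝ} (hx : 0 < x) (h : ∀ y ∈ Ioc 0 x, Z y = W y) :
    rl μ Z x = rl μ W x := by
  unfold rl
  split_ifs
  · exact h x ⟨hx, le_rfl⟩
  · congr 1
    refine intervalIntegral.integral_congr_ae (ae_of_all _ fun y hy => ?_)
    rw [uIoc_of_le hx.le] at hy
    rw [h y hy]

theorem rl_add {R ρ C ρ' C' μ x : ℝ} {Z W : ℝ → ℝ} (hμ : 0 ≤ μ) (hρ : 0 < ρ) (hρ' : 0 < ρ')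
    (hZ : WeightedBound R ρ C Z) (hW : WeightedBound R ρ' C' W) (hx : x ∈ Ioc 0 R) :
    rl μ (fun y => Z y + W y) x = rl μ Z x + rl μ W x := by
  unfold rl
  split_ifs with h
  · rfl
  · have hμ' := lt_of_le_of_ne hμ (Ne.symm h)
    rw [← mul_add, ← intervalIntegral.integral_add (hZ.intervalIntegrable hμ' hρ hx)
      (hW.intervalIntegrable hμ' hρ' hx)]
    simp only [mul_add]

theorem abs_rl_le_rl {μ x : ℝ} {Z W : ℝ → ℝ} (hμ : 0 ≤ μ) (hx : 0 < x)
    (h : ∀ y ∈ Ioc 0 x, |Z y| ≤ W y)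
    (hW : 0 < μ → IntervalIntegrable (fun y => (x - y) ^ (μ - 1) * W y) volume 0 x) :
    |rl μ Z x| ≤ rl μ W x := by
  unfold rl
  split_ifs with h0
  · exact h x ⟨hx, le_rfl⟩
  · have hμ' := lt_of_le_of_ne hμ (Ne.symm h0)
    have hΓ : 0 ≤ 1 / Real.Gamma μ := by have := Real.Gamma_pos_of_pos hμ'; positivity
    rw [abs_mul, abs_of_nonneg hΓ]
    refine mul_le_mul_of_nonneg_left ?_ hΓ
    rw [← Real.norm_eq_abs]
    refine intervalIntegral.norm_integral_le_of_norm_le hx.le (ae_of_all _ fun y hy => ?_) (hW hμ')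
    have h1 : 0 ≤ (x - y) ^ (μ - 1) := Real.rpow_nonneg (by linarith [hy.2]) _
    rw [norm_mul, Real.norm_of_nonneg h1, Real.norm_eq_abs]
    exact mul_le_mul_of_nonneg_left (h y hy) h1

theorem weightedBound_rpow (R ρ C : ℝ) (hC : 0 ≤ C) :
    WeightedBound R ρ C (fun y => C * y ^ (ρ - 1)) :=
  ⟨continuousOn_const.mul (continuousOn_id.rpow_const fun y hy => Or.inl hy.1.ne'), fun y hy => by
    rw [abs_of_nonneg (mul_nonneg hC (Real.rpow_nonneg hy.1.le _))]⟩

theorem rl_rpow {μ ρ C x : ℝ} (hμ : 0 ≤ μ) (hρ : 0 < ρ) (hx : 0 < x) :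
    rl μ (fun y => C * y ^ (ρ - 1)) x =
      C * (Real.Gamma ρ / Real.Gamma (μ + ρ)) * x ^ (μ + ρ - 1) := by
  have hΓρ := (Real.Gamma_pos_of_pos hρ).ne'
  unfold rl
  split_ifs with h0
  · subst h0
    rw [zero_add, div_self hΓρ, mul_one]
  · have hμ' := lt_of_le_of_ne hμ (Ne.symm h0)
    have hΓ := (Real.Gamma_pos_of_pos hμ').ne'
    simp only [mul_left_comm _ C]
    rw [intervalIntegral.integral_const_mul, integral_kernel hμ' hρ hx]
    field_simp

theorem WeightedBound.nonneg_const {R ρ C : ℝ} {Z : ℝ → ℝ} (hZ : WeightedBound R ρ C Z)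
    (hR : 0 < R) : 0 ≤ C := by
  have h := (abs_nonneg _).trans (hZ.2 R ⟨hR, le_rfl⟩)
  exact nonneg_of_mul_nonneg_left h (Real.rpow_pos_of_pos hR _)

theorem WeightedBound.abs_rl_le {R ρ C μ x : ℝ} {Z : ℝ → ℝ} (hZ : WeightedBound R ρ C Z)
    (hμ : 0 ≤ μ) (hρ : 0 < ρ) (hx : x ∈ Ioc 0 R) :
    |rl μ Z x| ≤ C * (Real.Gamma ρ / Real.Gamma (μ + ρ)) * x ^ (μ + ρ - 1) := by
  rw [← rl_rpow hμ hρ hx.1]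
  refine abs_rl_le_rl hμ hx.1 (fun y hy => hZ.2 y ⟨hy.1, hy.2.trans hx.2⟩) fun hμ' => ?_
  exact (weightedBound_rpow R ρ C (hZ.nonneg_const (hx.1.trans_le hx.2))).intervalIntegrable
    hμ' hρ hx

/-- Dominated convergence after scaling to `(0, 1]`: the bounded factor `h (x * σ)` is continuous in
`x`, and `C` times the beta integrand dominates. -/
theorem WeightedBound.continuousOn_rl {R ρ C μ : ℝ} {Z : ℝ → ℝ} (hZ : WeightedBound R ρ C Z)
    (hμ : 0 ≤ μ) (hρ : 0 < ρ) : ContinuousOn (rl μ Z) (Ioc 0 R) := by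
  rcases hμ.eq_or_lt with rfl | hμ
  · exact hZ.1.congr fun x _ => by simp [rl]
  obtain ⟨h, hc, hb, hZh⟩ := hZ.exists_eq_mul
  have hcont : ContinuousOn (fun x => ∫ σ in (0 : ℝ)..1,
      (1 - σ) ^ (μ - 1) * σ ^ (ρ - 1) * h (x * σ)) (Ioc 0 R) := by
    simp only [intervalIntegral.integral_of_le zero_le_one]
    have hmaps : ∀ x ∈ Ioc 0 R, ∀ σ ∈ Ioc (0 : ℝ) 1, x * σ ∈ Ioc 0 R := fun x hx σ hσ =>
      ⟨mul_pos hx.1 hσ.1, (mul_le_of_le_one_right hx.1.le hσ.2).trans hx.2⟩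
    have hint := (intervalIntegrable_iff_integrableOn_Ioc_of_le zero_le_one).1
      (intervalIntegrable_beta hμ hρ)
    refine continuousOn_of_dominated
      (bound := fun σ => C * ((1 - σ) ^ (μ - 1) * σ ^ (ρ - 1))) ?_ ?_ (hint.const_mul C) ?_
    · intro x hx
      refine hint.aestronglyMeasurable.mul (ContinuousOn.aestronglyMeasurable ?_ measurableSet_Ioc)
      exact hc.comp (by fun_prop) fun σ hσ => hmaps x hx σ hσ
    · intro x hx
      filter_upwards [ae_restrict_mem measurableSet_Ioc] with σ hσ
      have h0 : 0 ≤ (1 - σ) ^ (μ - 1) * σ ^ (ρ - 1) :=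
        mul_nonneg (Real.rpow_nonneg (by linarith [hσ.2]) _) (Real.rpow_nonneg hσ.1.le _)
      rw [norm_mul, Real.norm_of_nonneg h0, mul_comm]
      exact mul_le_mul_of_nonneg_right (hb _ (hmaps x hx σ hσ)) h0
    · filter_upwards [ae_restrict_mem measurableSet_Ioc] with σ hσ
      exact continuousOn_const.mul (hc.comp (by fun_prop) fun x hx => hmaps x hx σ hσ)
  have hpow : ContinuousOn (fun x : ℝ => x ^ (μ + ρ - 1)) (Ioc 0 R) :=
    continuousOn_id.rpow_const fun y hy => Or.inl hy.1.ne'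
  refine ((continuousOn_const (c := 1 / Real.Gamma μ)).mul (hpow.mul hcont)).congr fun x hx => ?_
  simp only [Pi.mul_apply]
  rw [rl_congr hx.1 fun y hy => hZh y ⟨hy.1, hy.2.trans hx.2⟩, rl, if_neg hμ.ne',
    integral_kernel_mul_comp_mul hx.1]

theorem WeightedBound.rl {R ρ C μ : ℝ} {Z : ℝ → ℝ} (hZ : WeightedBound R ρ C Z)
    (hμ : 0 ≤ μ) (hρ : 0 < ρ) :
    WeightedBound R (μ + ρ) (C * (Real.Gamma ρ / Real.Gamma (μ + ρ))) (rl μ Z) :=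
  ⟨hZ.continuousOn_rl hμ hρ, fun _ hx => hZ.abs_rl_le hμ hρ hx⟩

end RiemannLiouville

/-! ### The semigroup law -/

namespace RiemannLiouville

open MeasureTheory

/-- The integrand of the iterated integral `∫ τ in 0..x, (x - τ) ^ (μ - 1) * ∫ s in 0..τ, …`,
extended by zero to `τ ≤ s`. -/
noncomputable def semigroupKernel (μ ν x : ℝ) (V : ℝ → ℝ) (τ s : ℝ) : ℝ :=
  (if s < τ then (x - τ) ^ (μ - 1) * (τ - s) ^ (ν - 1) else 0) * V s

theorem semigroupKernel_eq_indicator_left (μ ν x : ℝ) (V : ℝ → ℝ) (s : ℝ) :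
    (fun τ => semigroupKernel μ ν x V τ s) =
      (Ioi s).indicator fun τ => (x - τ) ^ (μ - 1) * (τ - s) ^ (ν - 1) * V s := by
  ext τ
  by_cases h : s < τ <;> simp [semigroupKernel, h]

theorem semigroupKernel_eq_indicator_right (μ ν x : ℝ) (V : ℝ → ℝ) (τ : ℝ) :
    (fun s => semigroupKernel μ ν x V τ s) =
      (Iio τ).indicator fun s => (x - τ) ^ (μ - 1) * ((τ - s) ^ (ν - 1) * V s) := by
  ext s
  by_cases h : s < τ <;> simp [semigroupKernel, h, mul_assoc]

theorem integral_semigroupKernel_left {μ ν x s : ℝ} (V : ℝ → ℝ) (hμ : 0 < μ) (hν : 0 < ν)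
    (hs : 0 < s) (hsx : s < x) :
    ∫ τ in Ioc 0 x, semigroupKernel μ ν x V τ s =
      Real.Gamma μ * Real.Gamma ν / Real.Gamma (μ + ν) * ((x - s) ^ (μ + ν - 1) * V s) := by
  rw [semigroupKernel_eq_indicator_left, setIntegral_indicator measurableSet_Ioi,
    Ioc_inter_Ioi, sup_of_le_right hs.le, ← intervalIntegral.integral_of_le hsx.le,
    intervalIntegral.integral_mul_const, integral_kernel_shift hμ hν hsx]
  ring

theorem integral_semigroupKernel_right {μ ν x τ : ℝ} (V : ℝ → ℝ) (hτ : 0 < τ) (hτx : τ ≤ x) :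
    ∫ s in Ioc 0 x, semigroupKernel μ ν x V τ s =
      (x - τ) ^ (μ - 1) * ∫ s in (0 : ℝ)..τ, (τ - s) ^ (ν - 1) * V s := by
  have e : Ioc 0 x ∩ Iio τ = Ioo 0 τ := by
    ext y; simp only [mem_inter_iff, mem_Ioc, mem_Iio, mem_Ioo]
    constructor
    · rintro ⟨h, h'⟩; exact ⟨h.1, h'⟩
    · rintro ⟨h, h'⟩; exact ⟨⟨h, by linarith⟩, h'⟩
  rw [semigroupKernel_eq_indicator_right, setIntegral_indicator measurableSet_Iio, e,
    ← integral_Ioc_eq_integral_Ioo, integral_const_mul, intervalIntegral.integral_of_le hτ.le]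

theorem norm_semigroupKernel {μ ν x τ s : ℝ} (V : ℝ → ℝ) (hτ : τ ≤ x) :
    ‖semigroupKernel μ ν x V τ s‖ = semigroupKernel μ ν x (fun y => |V y|) τ s := by
  unfold semigroupKernel
  rw [norm_mul, Real.norm_eq_abs (V s), Real.norm_of_nonneg]
  split_ifs with h
  · exact mul_nonneg (Real.rpow_nonneg (by linarith) _) (Real.rpow_nonneg (by linarith) _)
  · exact le_rfl

/-- Tonelli's criterion with `τ` integrated first: in that order the inner integral of the absolute
value is an explicit beta integral, and the outer one is a fractional integrand of order `μ + ν`. -/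
theorem integrable_semigroupKernel {R ρ C μ ν x : ℝ} {V : ℝ → ℝ} (hV : WeightedBound R ρ C V)
    (hμ : 0 < μ) (hν : 0 < ν) (hρ : 0 < ρ) (hx : x ∈ Ioc 0 R) :
    Integrable (Function.uncurry (semigroupKernel μ ν x V))
      ((volume.restrict (Ioc 0 x)).prod (volume.restrict (Ioc 0 x))) := by
  -- The null endpoint `s = x` is discarded, since the shifted kernel needs `s < x`.
  have hae : ∀ᵐ s ∂volume.restrict (Ioc 0 x), 0 < s ∧ s < x := by
    rw [← restrict_Ioo_eq_restrict_Ioc]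
    exact ae_restrict_mem measurableSet_Ioo
  have hmeas : AEStronglyMeasurable (Function.uncurry (semigroupKernel μ ν x V))
      ((volume.restrict (Ioc 0 x)).prod (volume.restrict (Ioc 0 x))) := by
    have h1 : Measurable fun p : ℝ × ℝ =>
        if p.2 < p.1 then (x - p.1) ^ (μ - 1) * (p.1 - p.2) ^ (ν - 1) else 0 :=
      Measurable.ite (measurableSet_lt measurable_snd measurable_fst) (by fun_prop)
        measurable_const
    exact h1.aestronglyMeasurable.mul (hV.mono_right hx.2).aestronglyMeasurable.comp_snd
  rw [integrable_prod_iff' hmeas]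
  constructor
  · filter_upwards [hae] with s hs
    change Integrable (fun τ => semigroupKernel μ ν x V τ s) _
    rw [semigroupKernel_eq_indicator_left, integrable_indicator_iff measurableSet_Ioi,
      IntegrableOn, Measure.restrict_restrict measurableSet_Ioi, inter_comm, Ioc_inter_Ioi,
      sup_of_le_right hs.1.le]
    exact ((intervalIntegrable_iff_integrableOn_Ioc_of_le hs.2.le).1
      (intervalIntegrable_kernel_shift hμ hν hs.2)).mul_const _
  · have hV' : WeightedBound R ρ C fun y => |V y| := ⟨hV.1.abs, by simpa using hV.2⟩
    have hint := ((hV'.intervalIntegrable (add_pos hμ hν) hρ hx).const_mul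
      (Real.Gamma μ * Real.Gamma ν / Real.Gamma (μ + ν)))
    rw [intervalIntegrable_iff_integrableOn_Ioc_of_le hx.1.le] at hint
    refine hint.congr ?_
    filter_upwards [hae] with s hs
    rw [← integral_semigroupKernel_left (fun y => |V y|) hμ hν hs.1 hs.2]
    refine integral_congr_ae ?_
    filter_upwards [ae_restrict_mem measurableSet_Ioc] with τ hτ
    exact (norm_semigroupKernel V hτ.2).symm

/-- Fubini on the triangle `s < τ`: the integral in `τ` yields `Γ(μ)Γ(ν)/Γ(μ+ν)`, which cancels the
normalising factors. -/
theorem rl_rl {R ρ C μ ν x : ℝ} {V : ℝ → ℝ} (hV : WeightedBound R ρ C V)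
    (hμ : 0 ≤ μ) (hν : 0 < ν) (hρ : 0 < ρ) (hx : x ∈ Ioc 0 R) :
    rl μ (rl ν V) x = rl (μ + ν) V x := by
  rcases hμ.eq_or_lt with rfl | hμ
  · rw [zero_add, rl, if_pos rfl]
  have hswap := integral_integral_swap (integrable_semigroupKernel hV hμ hν hρ hx)
  have hl : ∫ τ in Ioc 0 x, ∫ s in Ioc 0 x, semigroupKernel μ ν x V τ s =
      Real.Gamma ν * ∫ τ in (0 : ℝ)..x, (x - τ) ^ (μ - 1) * rl ν V τ := by
    rw [← intervalIntegral.integral_const_mul, intervalIntegral.integral_of_le hx.1.le]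
    refine setIntegral_congr_fun measurableSet_Ioc fun τ hτ => ?_
    have hΓ := (Real.Gamma_pos_of_pos hν).ne'
    simp only [rl, if_neg hν.ne']
    rw [integral_semigroupKernel_right V hτ.1 hτ.2]
    field_simp
  have hr : ∫ s in Ioc 0 x, ∫ τ in Ioc 0 x, semigroupKernel μ ν x V τ s =
      Real.Gamma μ * Real.Gamma ν / Real.Gamma (μ + ν) *
        ∫ s in (0 : ℝ)..x, (x - s) ^ (μ + ν - 1) * V s := by
    rw [← intervalIntegral.integral_const_mul, intervalIntegral.integral_of_le hx.1.le,
      integral_Ioc_eq_integral_Ioo, integral_Ioc_eq_integral_Ioo]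
    exact setIntegral_congr_fun measurableSet_Ioo fun s hs =>
      integral_semigroupKernel_left V hμ hν hs.1 hs.2
  rw [hl, hr] at hswap
  have h1 := (Real.Gamma_pos_of_pos hμ).ne'
  have h2 := (Real.Gamma_pos_of_pos hν).ne'
  have h3 := (Real.Gamma_pos_of_pos (add_pos hμ hν)).ne'
  rw [rl, if_neg hμ.ne', rl, if_neg (add_pos hμ hν).ne']
  field_simp at hswap ⊢
  linarith

end RiemannLiouville

/-! ### The fixed-point equation for the perturbation -/

namespace RiemannLiouville

open BoundedContinuousFunction

/-- Extension by zero of a function on `(0, R]`. -/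
noncomputable def extendIoc (R : ℝ) (v : Ioc (0 : ℝ) R →ᵇ ℝ) : ℝ → ℝ :=
  Function.extend Subtype.val v 0

theorem extendIoc_apply {R : ℝ} (v : Ioc (0 : ℝ) R →ᵇ ℝ) (x : Ioc (0 : ℝ) R) :
    extendIoc R v x = v x :=
  Subtype.val_injective.extend_apply _ _ _

theorem continuousOn_extendIoc {R : ℝ} (v : Ioc (0 : ℝ) R →ᵇ ℝ) :
    ContinuousOn (extendIoc R v) (Ioc 0 R) := by
  rw [continuousOn_iff_continuous_domRestrict]
  convert v.continuous using 1
  ext x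
  exact extendIoc_apply v x

theorem weightedBound_one {R C : ℝ} {V : ℝ → ℝ} (hV : ContinuousOn V (Ioc 0 R))
    (hC : ∀ y ∈ Ioc 0 R, |V y| ≤ C) : WeightedBound R 1 C V :=
  ⟨hV, fun y hy => by simpa using hC y hy⟩

theorem weightedBound_extendIoc {R : ℝ} (v : Ioc (0 : ℝ) R →ᵇ ℝ) :
    WeightedBound R 1 ‖v‖ (extendIoc R v) :=
  weightedBound_one (continuousOn_extendIoc v) fun y hy => by
    rw [extendIoc_apply v ⟨y, hy⟩]; exact v.norm_coe_le_norm _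

theorem rl_sub {R C C' μ x : ℝ} {Z W : ℝ → ℝ} (hμ : 0 ≤ μ)
    (hZ : WeightedBound R 1 C Z) (hW : WeightedBound R 1 C' W) (hx : x ∈ Ioc 0 R) :
    rl μ (fun y => Z y - W y) x = rl μ Z x - rl μ W x := by
  have hD : WeightedBound R 1 (C + C') fun y => Z y - W y :=
    weightedBound_one (hZ.1.sub hW.1) fun y hy => (abs_sub _ _).trans <| by
      have h1 := hZ.2 y hy
      have h2 := hW.2 y hy
      simp only [sub_self, Real.rpow_zero, mul_one] at h1 h2
      exact add_le_add h1 h2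
  have h := rl_add hμ one_pos one_pos hD hW hx
  simp only [sub_add_cancel] at h
  rw [h, add_sub_cancel_right]

theorem abs_rl_le_of_bounded {α C x : ℝ} {V : ℝ → ℝ} (hα : 0 ≤ α) (hx : 0 < x)
    (hV : ContinuousOn V (Ioc 0 x)) (hC : ∀ y ∈ Ioc 0 x, |V y| ≤ C) :
    |rl α V x| ≤ C * (x ^ α / Real.Gamma (α + 1)) := by
  have h := (weightedBound_one hV hC).abs_rl_le hα one_pos ⟨hx, le_rfl⟩
  rw [Real.Gamma_one, add_sub_cancel_right] at h
  rwa [← mul_one_div, mul_comm (x ^ α), ← mul_assoc]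

/-- Banach's theorem on bounded continuous functions on `(0, R]`. `Z` and `G` may blow up at `0`,
but the difference `F - G` stays bounded by the residual estimate and the Lipschitz condition.
Working inside the closed set `|V| ≤ M Φ` gives the pointwise bound together with existence. -/
theorem exists_perturbation_fixedPoint {R α k l ε : ℝ} (hα : 0 < α) (hR : 0 < R) (hk : 0 < k)
    (hl : 0 < l) (hε : 0 < ε) (F : ℝ → ℝ → ℝ → ℝ)
    (hF : ContinuousOn (fun p : ℝ × ℝ × ℝ => F p.1 p.2.1 p.2.2) (Ioc 0 R ×ˢ univ))
    (hLip : ∀ x ∈ Ioc 0 R, ∀ u v u₁ v₁ : ℝ,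
      |F x u v - F x u₁ v₁| ≤ k * |u - u₁| + l * |v - v₁|)
    (hsmall : k * (R ^ α / Real.Gamma (α + 1)) + l < 1)
    (Z G Φ : ℝ → ℝ) (hZ : ContinuousOn Z (Ioc 0 R)) (hG : ContinuousOn G (Ioc 0 R))
    (hΦ0 : ∀ x ∈ Ioc 0 R, 0 ≤ Φ x) (hΦ : MonotoneOn Φ (Ioc 0 R))
    (hres : ∀ x ∈ Ioc 0 R, |G x - F x (Z x) (G x)| ≤ ε * Φ x) :
    ∃ V : ℝ → ℝ, ContinuousOn V (Ioc 0 R) ∧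
      (∀ x ∈ Ioc 0 R, |V x| ≤ ε / (1 - (k * (R ^ α / Real.Gamma (α + 1)) + l)) * Φ x) ∧
      ∀ x ∈ Ioc 0 R, G x + V x = F x (Z x + rl α V x) (G x + V x) := by
  set K := R ^ α / Real.Gamma (α + 1) with hK
  set M := ε / (1 - (k * K + l)) with hM
  have hΓ : 0 < Real.Gamma (α + 1) := Real.Gamma_pos_of_pos (by linarith)
  have hK0 : 0 ≤ K := by positivity
  have hd : 0 < 1 - (k * K + l) := by linarith
  have hM0 : 0 < M := div_pos hε hd
  -- `M` is chosen to solve this equation: residual plus Lipschitz contributions reproduce exactly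
  -- `M`.
  have hMeq : ε + k * (M * K) + l * M = M := by
    have : M * (1 - (k * K + l)) = ε := by rw [hM]; field_simp
    linarith
  have hpow : ∀ x ∈ Ioc 0 R, x ^ α / Real.Gamma (α + 1) ≤ K := fun x hx =>
    div_le_div_of_nonneg_right (Real.rpow_le_rpow hx.1.le hx.2 hα.le) hΓ.le
  have hrlK : ∀ x ∈ Ioc 0 R, ∀ (V : ℝ → ℝ) (C : ℝ), ContinuousOn V (Ioc 0 x) →
      (∀ y ∈ Ioc 0 x, |V y| ≤ C) → |rl α V x| ≤ C * K := by
    intro x hx V C hV hC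
    refine (abs_rl_le_of_bounded hα.le hx.1 hV hC).trans ?_
    exact mul_le_mul_of_nonneg_left (hpow x hx) ((abs_nonneg _).trans (hC x ⟨hx.1, le_rfl⟩))
  have hbound : ∀ V : ℝ → ℝ, ContinuousOn V (Ioc 0 R) → (∀ x ∈ Ioc 0 R, |V x| ≤ M * Φ x) →
      ∀ x ∈ Ioc 0 R, |F x (Z x + rl α V x) (G x + V x) - G x| ≤ M * Φ x := by
    intro V hV hVM x hx
    -- Monotonicity of `Φ` makes `M * Φ x` a constant bound for `V` on all of `(0, x]`.
    have h1 := hrlK x hx V (M * Φ x) (hV.mono (Ioc_subset_Ioc_right hx.2)) fun y hy => by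
      have hy' : y ∈ Ioc 0 R := ⟨hy.1, hy.2.trans hx.2⟩
      exact (hVM y hy').trans (mul_le_mul_of_nonneg_left (hΦ hy' hx hy.2) hM0.le)
    have h2 := hLip x hx (Z x + rl α V x) (G x + V x) (Z x) (G x)
    simp only [add_sub_cancel_left] at h2
    have h3 := hres x hx
    rw [abs_sub_comm] at h3
    have h4 := abs_sub_le (F x (Z x + rl α V x) (G x + V x)) (F x (Z x) (G x)) (G x)
    have h5 := mul_le_mul_of_nonneg_left h1 hk.le
    have h6 := mul_le_mul_of_nonneg_left (hVM x hx) hl.le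
    have h7 : (ε + k * (M * K) + l * M) * Φ x = M * Φ x := by rw [hMeq]
    linarith
  have hcont : ∀ (V : ℝ → ℝ) (C : ℝ), WeightedBound R 1 C V →
      ContinuousOn (fun x => F x (Z x + rl α V x) (G x + V x) - G x) (Ioc 0 R) := by
    intro V C hV
    refine ContinuousOn.sub (hF.comp (f := fun x => (x, Z x + rl α V x, G x + V x)) ?_ ?_) hG
    · exact continuousOn_id.prodMk
        ((hZ.add (hV.continuousOn_rl hα.le one_pos)).prodMk (hG.add hV.1))
    · exact fun x hx => ⟨hx, mem_univ _⟩
  let S : Set (Ioc (0 : ℝ) R →ᵇ ℝ) := {v | ∀ x, |v x| ≤ M * Φ x}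
  have hSclosed : IsClosed S := by
    simp only [S, ofPred_forall]
    refine isClosed_iInter fun x => isClosed_le ?_ continuous_const
    exact (continuous_eval_const x).abs
  have hS : ∀ v ∈ S, ∀ x ∈ Ioc 0 R, |extendIoc R v x| ≤ M * Φ x := fun v hv x hx => by
    rw [extendIoc_apply v ⟨x, hx⟩]; exact hv ⟨x, hx⟩
  have hRmem : R ∈ Ioc 0 R := ⟨hR, le_rfl⟩
  let T : S → S := fun v =>
    ⟨ofNormedAddCommGroup (fun x : Ioc (0 : ℝ) R =>
        F x (Z x + rl α (extendIoc R v) x) (G x + extendIoc R v x) - G x)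
      (continuousOn_iff_continuous_domRestrict.1 (hcont _ _ (weightedBound_extendIoc v.1)))
      (M * Φ R) fun x => (hbound _ (continuousOn_extendIoc _) (hS v v.2) x x.2).trans
        (mul_le_mul_of_nonneg_left (hΦ x.2 hRmem x.2.2) hM0.le),
      fun x => hbound _ (continuousOn_extendIoc _) (hS v v.2) x x.2⟩
  have hq : 0 ≤ k * K + l := by positivity
  have hT : ContractingWith ⟨k * K + l, hq⟩ T := by
    refine ⟨hsmall, LipschitzWith.of_dist_le_mul fun v w => ?_⟩
    rw [Subtype.dist_eq, Subtype.dist_eq, BoundedContinuousFunction.dist_le (by positivity)]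
    intro x
    change |(F x (Z x + rl α (extendIoc R v) x) (G x + extendIoc R v x) - G x) -
      (F x (Z x + rl α (extendIoc R w) x) (G x + extendIoc R w x) - G x)| ≤
        (k * K + l) * dist v.1 w.1
    have hdist : ∀ y ∈ Ioc 0 R, |extendIoc R v y - extendIoc R w y| ≤ dist v.1 w.1 := by
      intro y hy
      rw [extendIoc_apply v.1 ⟨y, hy⟩, extendIoc_apply w.1 ⟨y, hy⟩]
      exact dist_coe_le_dist (f := v.1) (g := w.1) ⟨y, hy⟩
    have h1 := hrlK x x.2 (fun y => extendIoc R v y - extendIoc R w y) (dist v.1 w.1)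
      (((continuousOn_extendIoc _).sub (continuousOn_extendIoc _)).mono
        (Ioc_subset_Ioc_right x.2.2)) fun y hy => hdist y ⟨hy.1, hy.2.trans x.2.2⟩
    rw [rl_sub hα.le (weightedBound_extendIoc _) (weightedBound_extendIoc _) x.2] at h1
    have h2 := hLip x x.2 (Z x + rl α (extendIoc R v) x) (G x + extendIoc R v x)
      (Z x + rl α (extendIoc R w) x) (G x + extendIoc R w x)
    simp only [add_sub_add_left_eq_sub] at h2
    rw [sub_sub_sub_cancel_right]
    have h3 := mul_le_mul_of_nonneg_left h1 hk.le
    have h4 := mul_le_mul_of_nonneg_left (hdist x x.2) hl.le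
    linarith
  have : Nonempty S := ⟨⟨0, fun x => by
    simpa using mul_nonneg hM0.le (hΦ0 x x.2)⟩⟩
  have : CompleteSpace S := hSclosed.completeSpace_coe
  let v := ContractingWith.fixedPoint T hT
  have hv : T v = v := hT.fixedPoint_isFixedPt
  refine ⟨extendIoc R v, continuousOn_extendIoc _, hS v v.2, fun x hx => ?_⟩
  have h := congrArg (fun w : S => w.1 ⟨x, hx⟩) hv
  change F x (Z x + rl α (extendIoc R v) x) (G x + extendIoc R v x) - G x = v.1 ⟨x, hx⟩ at h
  rw [← extendIoc_apply v.1 ⟨x, hx⟩] at h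
  simp only at h
  linarith

end RiemannLiouville

/-! ### Behaviour at 0 and the derivative of the integral of order 1 -/

namespace RiemannLiouville

open MeasureTheory

theorem rl_const_mul (μ c x : ℝ) (W : ℝ → ℝ) : rl μ (fun y => c * W y) x = c * rl μ W x := by
  unfold rl
  split_ifs
  · rfl
  · simp only [mul_left_comm _ c]
    rw [intervalIntegral.integral_const_mul]
    ring

theorem rl_zero_right {μ : ℝ} (hμ : 0 < μ) (V : ℝ → ℝ) : rl μ V 0 = 0 := by
  simp [rl, hμ.ne']

/-- At `0` the integral is squeezed by a multiple of `y ^ μ`; this is what leaves initial values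
unchanged. -/
theorem continuousOn_rl_Icc {R C μ : ℝ} {V : ℝ → ℝ} (hV : WeightedBound R 1 C V) (hμ : 0 < μ) :
    ContinuousOn (rl μ V) (Icc 0 R) := by
  intro x hx
  rcases hx.1.eq_or_lt with rfl | hx0
  · rw [ContinuousWithinAt, rl_zero_right hμ]
    have ht : Tendsto (fun y : ℝ => C * (Real.Gamma 1 / Real.Gamma (μ + 1)) * y ^ (μ + 1 - 1))
        (𝓝[Icc 0 R] 0) (𝓝 0) := by
      have h : ContinuousAt
          (fun y : ℝ => C * (Real.Gamma 1 / Real.Gamma (μ + 1)) * y ^ (μ + 1 - 1)) 0 :=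
        continuousAt_const.mul (Real.continuousAt_rpow_const _ _ (Or.inr (by linarith)))
      have h' := h.tendsto.mono_left (nhdsWithin_le_nhds (s := Icc 0 R))
      simpa [Real.zero_rpow hμ.ne'] using h'
    refine squeeze_zero_norm' ?_ ht
    filter_upwards [self_mem_nhdsWithin] with y hy
    rcases hy.1.eq_or_lt with rfl | hy0
    · rw [rl_zero_right hμ]
      simp [Real.zero_rpow hμ.ne']
    · exact hV.abs_rl_le hμ.le one_pos ⟨hy0, hy.2⟩
  · refine (hV.continuousOn_rl hμ.le one_pos x ⟨hx0, hx.2⟩).mono_of_mem_nhdsWithin ?_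
    rw [mem_nhdsWithin]
    exact ⟨Ioi 0, isOpen_Ioi, hx0, fun y hy => ⟨hy.1, hy.2.2⟩⟩

theorem hasDerivWithinAt_rl_one {R C x : ℝ} {V : ℝ → ℝ} (hV : WeightedBound R 1 C V)
    (hx : x ∈ Ioc 0 R) : HasDerivWithinAt (rl 1 V) (V x) (Ioc 0 R) x := by
  have hrl : rl 1 V = fun x => ∫ y in (0 : ℝ)..x, V y := by
    ext x
    simp [rl]
  have hint : IntervalIntegrable V volume 0 x := by
    simpa using hV.intervalIntegrable one_pos one_pos hx
  -- The fundamental theorem is applied on a closed interval away from the possible discontinuity at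
  -- `0`; it is one-sided when `x = R`.
  have hsub : Icc (x / 2) R ⊆ Ioc 0 R := fun y hy => ⟨by linarith [hx.1, hy.1], hy.2⟩
  have hmem : x ∈ Icc (x / 2) R := ⟨by linarith [hx.1], hx.2⟩
  have : Fact (x ∈ Icc (x / 2) R) := ⟨hmem⟩
  have hc : ContinuousOn V (Icc (x / 2) R) := hV.1.mono hsub
  have h := intervalIntegral.integral_hasDerivWithinAt_right hint (s := Icc (x / 2) R)
    (t := Icc (x / 2) R) (hc.stronglyMeasurableAtFilter_nhdsWithin measurableSet_Icc x)
    (hc x hmem)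
  rw [hrl]
  refine h.mono_of_mem_nhdsWithin ?_
  rw [mem_nhdsWithin]
  exact ⟨Ioi (x / 2), isOpen_Ioi, by simpa using hx.1, fun y hy => ⟨le_of_lt hy.1, hy.2.2⟩⟩

end RiemannLiouville

/-! ### The change of variable -/

namespace PsiHilfer

open MeasureTheory RiemannLiouville

/-- `θ` is the inverse of `t ↦ ψ t - ψ a`, a bijection of `[a, T]` onto `[0, ψ T - ψ a]`. -/
structure IsInverse (a T : ℝ) (ψ θ : ℝ → ℝ) : Prop where
  continuousOn : ContinuousOn θ (Icc 0 (ψ T - ψ a))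
  mapsTo : MapsTo θ (Ioc 0 (ψ T - ψ a)) (Ioc a T)
  left : ∀ t ∈ Icc a T, θ (ψ t - ψ a) = t
  right : ∀ x ∈ Icc 0 (ψ T - ψ a), ψ (θ x) - ψ a = x
  strictMonoOn : StrictMonoOn θ (Icc 0 (ψ T - ψ a))

theorem exists_isInverse {a T : ℝ} {ψ : ℝ → ℝ} (haT : a < T) (hc : ContinuousOn ψ (Icc a T))
    (hm : StrictMonoOn ψ (Icc a T)) : ∃ θ, IsInverse a T ψ θ := by
  set q : ℝ → ℝ := fun t => ψ t - ψ a with hq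
  have haI : a ∈ Icc a T := ⟨le_rfl, haT.le⟩
  have hTI : T ∈ Icc a T := ⟨haT.le, le_rfl⟩
  have hqm : StrictMonoOn q (Icc a T) := fun s hs t ht h => sub_lt_sub_right (hm hs ht h) _
  have hqI : MapsTo q (Icc a T) (Icc 0 (ψ T - ψ a)) := fun t ht =>
    ⟨sub_nonneg.2 (hm.monotoneOn haI ht ht.1), sub_le_sub_right (hm.monotoneOn ht hTI ht.2) _⟩
  have hsurj : SurjOn q (Icc a T) (Icc 0 (ψ T - ψ a)) := by
    have h := ContinuousOn.surjOn_Icc (f := q) (hc.sub continuousOn_const) haI hTI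
    rwa [show q a = 0 from sub_self _] at h
  set θ := Function.invFunOn q (Icc a T)
  have hθmem : ∀ x ∈ Icc 0 (ψ T - ψ a), θ x ∈ Icc a T := fun x hx =>
    Function.invFunOn_mem (hsurj hx)
  have hright : ∀ x ∈ Icc 0 (ψ T - ψ a), q (θ x) = x := fun x hx =>
    Function.invFunOn_eq (hsurj hx)
  have hleft : ∀ t ∈ Icc a T, θ (q t) = t := fun t ht =>
    hqm.injOn (hθmem _ (hqI ht)) ht (hright _ (hqI ht))
  have hθm : StrictMonoOn θ (Icc 0 (ψ T - ψ a)) := fun x hx y hy hxy => by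
    rw [← hqm.lt_iff_lt (hθmem x hx) (hθmem y hy), hright x hx, hright y hy]
    exact hxy
  refine ⟨θ, ?_, ?_, hleft, hright, hθm⟩
  -- A monotone surjection between intervals is continuous.
  · have hmono : Monotone (MapsTo.restrict θ _ _ hθmem) := fun x y hxy =>
      Subtype.coe_le_coe.1 (hθm.monotoneOn x.2 y.2 hxy)
    have hs : Function.Surjective (MapsTo.restrict θ _ _ hθmem) := fun t =>
      ⟨⟨q t, hqI t.2⟩, Subtype.ext (hleft t t.2)⟩
    rw [continuousOn_iff_continuous_domRestrict]
    exact continuous_subtype_val.comp (hmono.continuous_of_surjective hs)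
  · intro x hx
    have hx' : x ∈ Icc 0 (ψ T - ψ a) := Ioc_subset_Icc_self hx
    refine ⟨lt_of_le_of_ne (hθmem x hx').1 fun h => hx.1.ne ?_, (hθmem x hx').2⟩
    rw [← hright x hx', ← h, hq]
    simp

theorem sub_mem_Ioc {a T t : ℝ} {ψ : ℝ → ℝ} (hm : StrictMonoOn ψ (Icc a T))
    (ht : t ∈ Ioc a T) : ψ t - ψ a ∈ Ioc 0 (ψ T - ψ a) := by
  have ha : a ∈ Icc a T := ⟨le_rfl, ht.1.le.trans ht.2⟩
  have hT : T ∈ Icc a T := ⟨ht.1.le.trans ht.2, le_rfl⟩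
  exact ⟨sub_pos.2 (hm ha (Ioc_subset_Icc_self ht) ht.1),
    sub_le_sub_right (hm.monotoneOn (Ioc_subset_Icc_self ht) hT ht.2) _⟩

/-- Substitution `x = ψ s - ψ a`. Open intervals are used because `deriv ψ` is only known to be the
derivative of `ψ` at interior points of `[a, T]`. -/
theorem IsInverse.fracIntegral_eq_rl {a T t : ℝ} {ψ θ : ℝ → ℝ} (hθ : IsInverse a T ψ θ)
    (hd : DifferentiableOn ℝ ψ (Icc a T)) (hm : StrictMonoOn ψ (Icc a T))
    (μ : ℝ) (h : ℝ → ℝ) (ht : t ∈ Ioc a T) :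
    fracIntegral a ψ μ h t = rl μ (fun x => h (θ x)) (ψ t - ψ a) := by
  have htI := Ioc_subset_Icc_self ht
  unfold fracIntegral rl
  split_ifs
  · simp only [hθ.left t htI]
  congr 1
  have hq := sub_mem_Ioc hm ht
  have hsub : Ioo a t ⊆ Icc a T := fun s hs => ⟨hs.1.le, hs.2.le.trans ht.2⟩
  have himage : (fun s => ψ s - ψ a) '' Ioo a t = Ioo 0 (ψ t - ψ a) := by
    ext x
    constructor
    · rintro ⟨s, hs, rfl⟩
      exact ⟨(sub_mem_Ioc hm ⟨hs.1, hs.2.le.trans ht.2⟩).1,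
        sub_lt_sub_right (hm (hsub hs) htI hs.2) _⟩
    · intro hx
      have hxI : x ∈ Ioc 0 (ψ T - ψ a) := ⟨hx.1, hx.2.le.trans hq.2⟩
      refine ⟨θ x, ⟨(hθ.mapsTo hxI).1, ?_⟩, hθ.right x (Ioc_subset_Icc_self hxI)⟩
      rw [← hθ.left t htI]
      exact hθ.strictMonoOn (Ioc_subset_Icc_self hxI) (Ioc_subset_Icc_self hq) hx.2
  rw [intervalIntegral.integral_of_le ht.1.le, intervalIntegral.integral_of_le hq.1.le,
    integral_Ioc_eq_integral_Ioo, integral_Ioc_eq_integral_Ioo, ← himage,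
    integral_image_eq_integral_deriv_smul_of_monotoneOn (f' := deriv ψ) measurableSet_Ioo]
  · refine setIntegral_congr_fun measurableSet_Ioo fun s hs => ?_
    simp only [smul_eq_mul]
    rw [hθ.left s (hsub hs), sub_sub_sub_cancel_right, mul_assoc]
  · intro s hs
    have hnhds : Icc a T ∈ 𝓝 s := Icc_mem_nhds hs.1 (hs.2.trans_le ht.2)
    exact (((hd s (hsub hs)).differentiableAt hnhds).hasDerivAt.sub_const _).hasDerivWithinAt
  · exact fun s hs s' hs' hss => sub_le_sub_right (hm.monotoneOn (hsub hs) (hsub hs') hss) _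

theorem gam_pos {α β : ℝ} (hα : 0 < α) (hα1 : α ≤ 1) (hβ : 0 ≤ β) : 0 < gam α β :=
  add_pos_of_pos_of_nonneg hα (mul_nonneg hβ (sub_nonneg.2 hα1))

theorem one_sub_gam_nonneg {α β : ℝ} (hα1 : α ≤ 1) (hβ1 : β ≤ 1) : 0 ≤ 1 - gam α β := by
  have := mul_nonneg (sub_nonneg.2 hβ1) (sub_nonneg.2 hα1)
  rw [gam]
  linarith

theorem MemWeighted.exists_weightedBound {a T γ : ℝ} {ψ θ z : ℝ → ℝ}
    (hz : MemWeighted a T ψ γ z) (hθ : IsInverse a T ψ θ) :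
    ∃ C, WeightedBound (ψ T - ψ a) γ C fun x => z (θ x) := by
  obtain ⟨h, hc, hh⟩ := hz
  obtain ⟨C, hC⟩ := isCompact_Icc.exists_bound_of_continuousOn hc
  have hzθ : ∀ x ∈ Ioc 0 (ψ T - ψ a), z (θ x) = x ^ (γ - 1) * h (θ x) := fun x hx => by
    rw [← hh _ (hθ.mapsTo hx), hθ.right x (Ioc_subset_Icc_self hx), ← mul_assoc,
      rpow_mul_rpow_neg hx.1, one_mul]
  refine ⟨C, ?_, fun x hx => ?_⟩
  · refine ContinuousOn.congr ?_ hzθ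
    refine (continuousOn_id.rpow_const fun x hx => Or.inl hx.1.ne').mul ?_
    exact hc.comp (hθ.continuousOn.mono Ioc_subset_Icc_self) fun x hx =>
      Ioc_subset_Icc_self (hθ.mapsTo hx)
  · have hp := Real.rpow_pos_of_pos hx.1 (γ - 1)
    simp only
    rw [hzθ x hx, abs_mul, abs_of_pos hp, mul_comm]
    exact mul_le_mul_of_nonneg_right (hC _ (Ioc_subset_Icc_self (hθ.mapsTo hx))) hp.le

/-! ### Adding a fractional integral of order `α` to `z` -/

section Perturbation

variable {a T α β C : ℝ} {ψ θ z V : ℝ → ℝ}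

theorem continuousOn_rl_comp {p : ℝ} (hψ : ContinuousOn ψ (Icc a T))
    (hm : StrictMonoOn ψ (Icc a T)) (hV : WeightedBound (ψ T - ψ a) 1 C V) (hp : 0 < p) :
    ContinuousOn (fun t => rl p V (ψ t - ψ a)) (Icc a T) := by
  refine (continuousOn_rl_Icc hV hp).comp (hψ.sub continuousOn_const) fun t ht => ?_
  rcases ht.1.eq_or_lt with rfl | h
  · rw [sub_self]
    exact ⟨le_rfl, sub_nonneg.2 (hm.monotoneOn ht ⟨ht.2, le_rfl⟩ ht.2)⟩
  · exact Ioc_subset_Icc_self (sub_mem_Ioc hm ⟨h, ht.2⟩)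

theorem MemWeighted.add_rl (hψ : ContinuousOn ψ (Icc a T)) (hm : StrictMonoOn ψ (Icc a T))
    (hα : 0 < α) (hα1 : α ≤ 1) (hβ1 : β ≤ 1) (hz : MemWeighted a T ψ (gam α β) z)
    (hV : WeightedBound (ψ T - ψ a) 1 C V) :
    MemWeighted a T ψ (gam α β) fun t => z t + rl α V (ψ t - ψ a) := by
  obtain ⟨h, hc, hh⟩ := hz
  refine ⟨fun t => h t + (ψ t - ψ a) ^ (1 - gam α β) * rl α V (ψ t - ψ a), ?_, fun t ht => ?_⟩
  · refine hc.add (ContinuousOn.mul ?_ (continuousOn_rl_comp hψ hm hV hα))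
    exact (hψ.sub continuousOn_const).rpow_const fun _ _ =>
      Or.inr (one_sub_gam_nonneg hα1 hβ1)
  · rw [mul_add, hh t ht]

theorem fracIntegral_add_rl (hd : DifferentiableOn ℝ ψ (Icc a T))
    (hm : StrictMonoOn ψ (Icc a T)) (hθ : IsInverse a T ψ θ)
    (hα : 0 < α) (hα1 : α ≤ 1) (hβ : 0 ≤ β) (hβ1 : β ≤ 1)
    (hz : MemWeighted a T ψ (gam α β) z) (hV : WeightedBound (ψ T - ψ a) 1 C V)
    {t : ℝ} (ht : t ∈ Ioc a T) :
    fracIntegral a ψ (1 - gam α β) (fun t => z t + rl α V (ψ t - ψ a)) t =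
      fracIntegral a ψ (1 - gam α β) z t + rl (1 - gam α β + α) V (ψ t - ψ a) := by
  obtain ⟨Cz, hZ⟩ := hz.exists_weightedBound hθ
  have hγ := one_sub_gam_nonneg hα1 hβ1
  have hq := sub_mem_Ioc hm ht
  rw [hθ.fracIntegral_eq_rl hd hm _ _ ht, hθ.fracIntegral_eq_rl hd hm _ _ ht,
    rl_congr (W := fun x => z (θ x) + rl α V x) hq.1 fun x hx => by
      rw [hθ.right x ⟨hx.1.le, hx.2.trans hq.2⟩],
    rl_add hγ (gam_pos hα hα1 hβ) (add_pos hα one_pos) hZ (hV.rl hα.le one_pos) hq,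
    rl_rl hV hγ hα one_pos hq]

theorem HasInitialValue.add_rl (haT : a < T) (hd : DifferentiableOn ℝ ψ (Icc a T))
    (hm : StrictMonoOn ψ (Icc a T)) (hθ : IsInverse a T ψ θ)
    (hα : 0 < α) (hα1 : α ≤ 1) (hβ : 0 ≤ β) (hβ1 : β ≤ 1)
    (hz : MemWeighted a T ψ (gam α β) z) (hV : WeightedBound (ψ T - ψ a) 1 C V) {L : ℝ}
    (hL : HasInitialValue a ψ α β z L) :
    HasInitialValue a ψ α β (fun t => z t + rl α V (ψ t - ψ a)) L := by
  have hp : 0 < 1 - gam α β + α :=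
    add_pos_of_nonneg_of_pos (one_sub_gam_nonneg hα1 hβ1) hα
  have h0 : Tendsto (fun t => rl (1 - gam α β + α) V (ψ t - ψ a)) (𝓝[>] a) (𝓝 0) := by
    have h := continuousOn_rl_comp hd.continuousOn hm hV hp a ⟨le_rfl, haT.le⟩
    rw [ContinuousWithinAt, sub_self, rl_zero_right hp] at h
    rw [← nhdsWithin_Ioc_eq_nhdsGT haT]
    exact h.mono_left (nhdsWithin_mono _ Ioc_subset_Icc_self)
  have hsum := Tendsto.add hL h0
  rw [add_zero] at hsum
  refine hsum.congr' ?_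
  filter_upwards [Ioc_mem_nhdsGT haT] with t ht
  exact (fracIntegral_add_rl hd hm hθ hα hα1 hβ hβ1 hz hV ht).symm

/-- The added term contributes `I^1 V` to the function being differentiated, by the semigroup law
and `hsum`; the chain rule then gives `ψ' V`. -/
theorem hasHilferDeriv_add_rl (haT : a < T) (hd : DifferentiableOn ℝ ψ (Icc a T))
    (hm : StrictMonoOn ψ (Icc a T)) (hθ : IsInverse a T ψ θ)
    (hα : 0 < α) (hα1 : α ≤ 1) (hβ : 0 ≤ β) (hβ1 : β ≤ 1)
    (hz : MemWeighted a T ψ (gam α β) z) (hV : WeightedBound (ψ T - ψ a) 1 C V) {g : ℝ → ℝ}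
    (hg : HasHilferDeriv a T ψ α β z g) :
    HasHilferDeriv a T ψ α β (fun t => z t + rl α V (ψ t - ψ a))
      (fun t => g t + V (ψ t - ψ a)) := by
  obtain ⟨L, hL, hder⟩ := hg
  obtain ⟨Cz, hZ⟩ := hz.exists_weightedBound hθ
  have hγ := one_sub_gam_nonneg hα1 hβ1
  have hγ0 := gam_pos hα hα1 hβ
  have hp : 0 < 1 - gam α β + α := add_pos_of_nonneg_of_pos hγ hα
  have hμ : 0 ≤ β * (1 - α) := mul_nonneg hβ (sub_nonneg.2 hα1)
  have hsum : β * (1 - α) + (1 - gam α β + α) = 1 := by rw [gam]; ring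
  refine ⟨L, hL.add_rl haT hd hm hθ hα hα1 hβ hβ1 hz hV, fun t ht => ?_⟩
  -- Order `1 - γ` cancels the singularity `x ^ (γ - 1)` of `z`, so the result is bounded (weight
  -- exponent `1`) and subtracting `L` keeps it so.
  have hIz : ∃ C', WeightedBound (ψ T - ψ a) 1 C' fun x =>
      rl (1 - gam α β) (fun x => z (θ x)) x - L := by
    have h := hZ.rl hγ hγ0
    rw [sub_add_cancel] at h
    refine ⟨Cz * (Real.Gamma (gam α β) / Real.Gamma 1) + |L|, weightedBound_one (h.1.sub continuousOn_const) fun x hx =>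
      (abs_sub _ _).trans (add_le_add_left ?_ _)⟩
    have h2 := h.2 x hx
    rwa [sub_self, Real.rpow_zero, mul_one] at h2
  obtain ⟨C', hIz⟩ := hIz
  have hkey : ∀ t ∈ Ioc a T,
      fracIntegral a ψ (β * (1 - α)) (fun s => fracIntegral a ψ (1 - gam α β)
        (fun t => z t + rl α V (ψ t - ψ a)) s - L) t =
      fracIntegral a ψ (β * (1 - α)) (fun s => fracIntegral a ψ (1 - gam α β) z s - L) t +
        rl 1 V (ψ t - ψ a) := by
    intro t ht
    have hq := sub_mem_Ioc hm ht
    rw [hθ.fracIntegral_eq_rl hd hm _ _ ht, hθ.fracIntegral_eq_rl hd hm _ _ ht,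
      rl_congr (W := fun x => (rl (1 - gam α β) (fun x => z (θ x)) x - L) +
        rl (1 - gam α β + α) V x) hq.1 fun x hx => ?_,
      rl_add hμ one_pos (add_pos hp one_pos) hIz (hV.rl hp.le one_pos) hq,
      rl_rl hV hμ hp one_pos hq, hsum]
    · congr 1
      refine rl_congr hq.1 fun x hx => ?_
      have hx' : x ∈ Ioc 0 (ψ T - ψ a) := ⟨hx.1, hx.2.trans hq.2⟩
      rw [hθ.fracIntegral_eq_rl hd hm _ _ (hθ.mapsTo hx'), hθ.right x (Ioc_subset_Icc_self hx')]
    · have hx' : x ∈ Ioc 0 (ψ T - ψ a) := ⟨hx.1, hx.2.trans hq.2⟩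
      rw [fracIntegral_add_rl hd hm hθ hα hα1 hβ hβ1 hz hV (hθ.mapsTo hx'),
        hθ.fracIntegral_eq_rl hd hm _ _ (hθ.mapsTo hx'), hθ.right x (Ioc_subset_Icc_self hx')]
      ring
  have hψ' : HasDerivWithinAt (fun t => ψ t - ψ a) (derivWithin ψ (Icc a T) t) (Ioc a T) t :=
    ((hd t (Ioc_subset_Icc_self ht)).hasDerivWithinAt.mono Ioc_subset_Icc_self).sub_const _
  have hcomp : HasDerivWithinAt (fun t => rl 1 V (ψ t - ψ a))
      (V (ψ t - ψ a) * derivWithin ψ (Icc a T) t) (Ioc a T) t :=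
    HasDerivWithinAt.comp (h₂ := rl 1 V) t (hasDerivWithinAt_rl_one hV (sub_mem_Ioc hm ht)) hψ'
      fun s hs => sub_mem_Ioc hm hs
  rw [mul_add, mul_comm _ (V _)]
  exact ((hder t ht).add hcomp).congr hkey (hkey t ht)

end Perturbation

end PsiHilfer

/-! ### Ulam-Hyers-Rassias stability -/

open PsiHilfer RiemannLiouville in
theorem theorem6
    (a T α β : ℝ) (haT : a < T) (hα : 0 < α) (hα1 : α ≤ 1) (hβ : 0 ≤ β) (hβ1 : β ≤ 1)
    (ψ : ℝ → ℝ) (hψ : ContDiffOn ℝ 1 ψ (Icc a T)) (hψmono : StrictMonoOn ψ (Icc a T))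
    (hψne : ∀ t ∈ Icc a T, derivWithin ψ (Icc a T) t ≠ 0)
    (f : ℝ → ℝ → ℝ → ℝ)
    (hf : ContinuousOn (fun p : ℝ × ℝ × ℝ => f p.1 p.2.1 p.2.2) (Icc a T ×ˢ univ))
    (k l : ℝ) (hk : 0 < k) (hl : 0 < l)
    (hLip : ∀ t ∈ Icc a T, ∀ u v u₁ v₁ : ℝ,
      |f t u v - f t u₁ v₁| ≤ k * |u - u₁| + l * |v - v₁|)
    (hsmall : k / Real.Gamma (α + 1) * (ψ T - ψ a) ^ α + l < 1)
    (φ : ℝ → ℝ) (hφ : ContinuousOn φ (Icc a T)) (hφ0 : ∀ t ∈ Icc a T, 0 ≤ φ t)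
    (hφmono : MonotoneOn φ (Icc a T))
    (lam : ℝ) (hlam : 0 < lam)
    (hφint : ∀ t ∈ Icc a T, PsiHilfer.fracIntegral a ψ α φ t ≤ lam * φ t) :
    PsiHilfer.UlamHyersRassiasStableWith a T ψ α β f φ
      ((1 - k * (ψ T - ψ a) ^ α / ((1 - l) * Real.Gamma (α + 1)))⁻¹ * (lam / (1 - l))) := by
  have hd : DifferentiableOn ℝ ψ (Icc a T) := hψ.differentiableOn one_ne_zero
  obtain ⟨θ, hθ⟩ := exists_isInverse haT hψ.continuousOn hψmono
  have hTmem : T ∈ Ioc a T := ⟨haT, le_rfl⟩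
  have hR : 0 < ψ T - ψ a := (sub_mem_Ioc hψmono hTmem).1
  have hΓ : 0 < Real.Gamma (α + 1) := Real.Gamma_pos_of_pos (by linarith)
  have hRα : 0 < (ψ T - ψ a) ^ α := Real.rpow_pos_of_pos hR _
  set K := (ψ T - ψ a) ^ α / Real.Gamma (α + 1) with hK
  have hK0 : 0 < K := div_pos hRα hΓ
  have hsmall' : k * K + l < 1 := by
    rw [hK, mul_div_assoc', ← div_mul_eq_mul_div]; exact hsmall
  have hkK : 0 < k * K := mul_pos hk hK0
  have hl1 : 0 < 1 - l := by linarith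
  have hden : 0 < 1 - (k * K + l) := by linarith
  -- Cancelling `1 - l` exhibits the stated constant as `lam / (1 - q)`, with `q = k * K + l` the
  -- contraction factor.
  have hconst : (1 - k * (ψ T - ψ a) ^ α / ((1 - l) * Real.Gamma (α + 1)))⁻¹ * (lam / (1 - l)) =
      lam / (1 - (k * K + l)) := by
    have e : 1 - k * (ψ T - ψ a) ^ α / ((1 - l) * Real.Gamma (α + 1)) =
        (1 - (k * K + l)) / (1 - l) := by
      rw [hK]; field_simp; ring
    rw [e, inv_div]
    field_simp
  rw [hconst]
  refine ⟨div_pos hlam hden, fun ε hε z hz => ?_⟩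
  obtain ⟨hzmem, g, hgc, hgD, hres⟩ := hz
  obtain ⟨L, hL, -⟩ := id hgD
  obtain ⟨Cz, hZ⟩ := hzmem.exists_weightedBound hθ
  have hθI : MapsTo θ (Ioc 0 (ψ T - ψ a)) (Icc a T) := fun x hx =>
    Ioc_subset_Icc_self (hθ.mapsTo hx)
  have hθc : ContinuousOn θ (Ioc 0 (ψ T - ψ a)) := hθ.continuousOn.mono Ioc_subset_Icc_self
  have hθm : MonotoneOn θ (Ioc 0 (ψ T - ψ a)) :=
    hθ.strictMonoOn.monotoneOn.mono Ioc_subset_Icc_self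
  have hF : ContinuousOn (fun p : ℝ × ℝ × ℝ => f (θ p.1) p.2.1 p.2.2)
      (Ioc 0 (ψ T - ψ a) ×ˢ univ) := by
    refine hf.comp (f := fun p : ℝ × ℝ × ℝ => (θ p.1, p.2)) ?_ fun p hp => ⟨hθI hp.1, mem_univ _⟩
    exact (hθc.comp continuousOn_fst fun p hp => hp.1).prodMk continuousOn_snd
  obtain ⟨V, hVc, hVb, hVeq⟩ := exists_perturbation_fixedPoint hα hR hk hl hε
    (fun x u v => f (θ x) u v) hF (fun x hx => hLip _ (hθI hx)) hsmall'
    (fun x => z (θ x)) (fun x => g (θ x)) (fun x => φ (θ x)) hZ.1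
    (hgc.comp hθc hθ.mapsTo) (fun x hx => hφ0 _ (hθI hx))
    (fun x hx y hy hxy => hφmono (hθI hx) (hθI hy) (hθm hx hy hxy))
    (fun x hx => hres _ (hθ.mapsTo hx))
  have hΦ : WeightedBound (ψ T - ψ a) 1 (φ T) fun x => φ (θ x) :=
    weightedBound_one (hφ.comp hθc hθI) fun x hx => by
      rw [abs_of_nonneg (hφ0 _ (hθI hx))]
      exact hφmono (hθI hx) (Ioc_subset_Icc_self hTmem) (hθI hx).2
  set M := ε / (1 - (k * K + l)) with hM
  have hM0 : 0 < M := div_pos hε hden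
  have hV : WeightedBound (ψ T - ψ a) 1 (M * φ T) V := weightedBound_one hVc fun x hx =>
    (hVb x hx).trans (mul_le_mul_of_nonneg_left
      (hφmono (hθI hx) (Ioc_subset_Icc_self hTmem) (hθI hx).2) hM0.le)
  refine ⟨L, fun t => z t + rl α V (ψ t - ψ a), hL,
    ⟨hzmem.add_rl hψ.continuousOn hψmono hα hα1 hβ1 hV,
      hL.add_rl haT hd hψmono hθ hα hα1 hβ hβ1 hzmem hV,
      fun t => g t + V (ψ t - ψ a), ?_,
      hasHilferDeriv_add_rl haT hd hψmono hθ hα hα1 hβ hβ1 hzmem hV hgD, fun t ht => ?_⟩,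
    fun t ht => ?_⟩
  · exact hgc.add (hVc.comp ((hψ.continuousOn.mono Ioc_subset_Icc_self).sub continuousOn_const)
      fun t ht => sub_mem_Ioc hψmono ht)
  · have h := hVeq _ (sub_mem_Ioc hψmono ht)
    simpa only [hθ.left t (Ioc_subset_Icc_self ht)] using h
  · have hq := sub_mem_Ioc hψmono ht
    rw [sub_add_cancel_left, abs_neg]
    -- The pointwise bound on `V` is integrated before `hφint` is used; a sup bound on `V` would
    -- lose the factor `φ t`.
    have h1 : |rl α V (ψ t - ψ a)| ≤ rl α (fun x => M * φ (θ x)) (ψ t - ψ a) :=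
      abs_rl_le_rl hα.le hq.1 (fun x hx => hVb x ⟨hx.1, hx.2.trans hq.2⟩) fun _ => by
        have h := (hΦ.intervalIntegrable hα one_pos hq).const_mul M
        simpa only [mul_left_comm M] using h
    rw [rl_const_mul, ← hθ.fracIntegral_eq_rl hd hψmono α φ ht] at h1
    refine h1.trans ((mul_le_mul_of_nonneg_left (hφint t (Ioc_subset_Icc_self ht)) hM0.le).trans
      (le_of_eq ?_))
    rw [hM]
    ring
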